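/- **Model.** Let $r\ge 2$, $d\ge 0$ and let $\mu_1,\dots,\mu_r\in\mathbb R^d$. Draw $n$ inliers independently: inlier $i$ has a random label $\phi_i\in\{1,\dots,r\}$ with $P(\phi_i=k)=\pi_k$, and, given $\phi_i=k$, position $y_i=\mu_k+\xi_i$, where $\xi_i\sim\mathcal D_k$ has mean zero and is sub-gaussian with parameter $\sigma_k>0$, that is, $E\,e^{\langle c,\xi_i\rangle}\le e^{\sigma_k^2\|c\|^2/2}$ for all $c\in\mathbb R^d$. In addition there are $m$ outliers, with index set $\mathcal O$; they are arbitrary random points of $\mathbb R^d$, which may depend on the inliers and on each other. Put $N=n+m$, $\sigma_{\max}=\max_k\sigma_k$, $\Delta_{\min}=\min_{k\ne l}\|\mu_k-\mu_l\|$, let $n_{\min}$ be the size of the smallest of the $r$ inlier clusters $\{i:\phi_i=k\}$, and let $X^0\in\{0,1\}^{N\times N}$ have $X^0_{ij}=1$ if and only if $i,j$ are inliers with the same label. For $\theta>0$ let $K_{ij}=\exp(-\|y_i-y_j\|^2/(2\theta^2))$, and let $\hat X$ be an optimal solution of: maximize $\sum_{i,j}(K_{ij}-\gamma)X_{ij}$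 subject to $0\le X_{ij}\le 1$ for all $i,j$. Write $\|X\|_1=\sum_{i,j}|X_{ij}|$. **Good and bad outliers.** Given a number $b$, an outlier $i\in\mathcal O$ is good (with bound $b$) if $\|y_i-\mu_k\|\ge\sqrt2\,\Delta_{\min}$ for all $k$ and $|\{j\in\mathcal O:\|y_i-y_j\|\le\Delta_{\min}/\sqrt2\}|\le b$. **Proposition.** For every $A>0$ there is a constant $C'>0$ depending only on $A$ with the following property. For every $g:\mathbb N\to\mathbb R$ with $g(n)=o(n)$ and every $S$ there is an $n_0$, depending only on $A$, $g$ and $S$, such that the following holds whenever $n\ge n_0$ and $\Delta_{\min}\le S\sigma_{\max}$. Suppose that $\Delta_{\min}\ge 8\sigma_{\max}\sqrt d$, $\theta>0$ and $$\exp\Big(-\frac{\Delta_{\min}^2}{4\theta^2}\Big)<\gamma<\exp\Big(-\frac{5\Delta_{\min}^2}{64\theta^2}\Big).$$ Then, conditionally on any vector of inlier labels which has positive probability and satisfies $n_{\min}>r$, with probability at least $1-3r/n_{\min}$ every optimal solution $\hat X$ and every set $\mathcal O_g\subset\mathcal O$ of good outliers (with bound $g(n)$) such that $|\mathcal O_g|\le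 An$ and such that $\mathcal O_b:=\mathcal O\setminus\mathcal O_g$ has $|\mathcal O_b|\le g(n)$ satisfy $$\frac{\|\hat X-X^0\|_1}{\|X^0\|_1}\le C'r\max\left\{\exp\Big(-\frac{\Delta_{\min}^2}{64\sigma_{\max}^2}\Big),\sqrt{\frac{\log n_{\min}}{n_{\min}}}\right\}+\frac{2r|\mathcal O_b|}{n}.$$ -/

import Mathlib

open MeasureTheory ProbabilityTheory Filter Asymptotics
open scoped NNReal

namespace RobustClustering

noncomputable section

/-- A mixture of `r` sub-gaussian distributions on `ℝ^d`. The `k`-th component has weight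
`weight k` and is the law of `mean k + ξ`, where `ξ` has law `noise k`, mean zero, and is
sub-gaussian with parameter `scale k`: `E exp ⟨c, ξ⟩ ≤ exp (‖c‖² (scale k)² / 2)` for all `c`. -/
structure SubGaussianMixture (r d : ℕ) where
  weight : PMF (Fin r)
  mean : Fin r → EuclideanSpace ℝ (Fin d)
  noise : Fin r → Measure (EuclideanSpace ℝ (Fin d))
  isProbabilityMeasure_noise : ∀ k, IsProbabilityMeasure (noise k)
  scale : Fin r → ℝ≥0
  scale_pos : ∀ k, 0 < scale k
  integral_noise : ∀ k, ∫ x, x ∂(noise k) = 0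
  subgaussian_noise : ∀ k, ∀ u : EuclideanSpace ℝ (Fin d), ‖u‖ = 1 →
    HasSubgaussianMGF (fun x => inner ℝ u x) (scale k ^ 2) (noise k)

namespace SubGaussianMixture

variable {r d : ℕ} (M : SubGaussianMixture r d)

/-- The largest sub-gaussian parameter `σ_max`. -/
def sigmaMax : ℝ := ⨆ k : Fin r, (M.scale k : ℝ)

/-- The minimum separation `Δ_min` between two different centers (for `r ≥ 2`). -/
def deltaMin : ℝ :=
  ⨅ p : {p : Fin r × Fin r // p.1 ≠ p.2}, ‖M.mean p.1.1 - M.mean p.1.2‖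

end SubGaussianMixture

/-- `φ` and `x` are the labels and positions of `n` independent points drawn from the mixture `M`:
the pairs `(φ i, x i)` are independent, `φ i = k` has probability `weight k`, and given `φ i = k`
the noise `x i - mean k` has law `noise k`. -/
structure IsMixtureSample {Ω : Type*} [MeasurableSpace Ω] (P : Measure Ω) {r d n : ℕ}
    (M : SubGaussianMixture r d) (φ : Fin n → Ω → Fin r)
    (x : Fin n → Ω → EuclideanSpace ℝ (Fin d)) : Prop where
  measurable_label : ∀ i, Measurable (φ i)
  measurable_point : ∀ i, Measurable (x i)
  indep : iIndepFun (fun i ω => (φ i ω, x i ω)) P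
  law : ∀ (i : Fin n) (k : Fin r) (B : Set (EuclideanSpace ℝ (Fin d))), MeasurableSet B →
    P {ω | φ i ω = k ∧ x i ω - M.mean k ∈ B} = M.weight k * M.noise k B

/-- The cardinality `n_min` of the smallest cluster of a label vector. -/
def minClusterSize {n r : ℕ} (l : Fin n → Fin r) : ℕ :=
  ⨅ k : Fin r, (Finset.univ.filter fun i => l i = k).card

/-- The true membership matrix `Z⁰`; the `n` inliers come first, then the `m` outliers, whose
rows are zero. -/
def trueMembership {n r : ℕ} (m : ℕ) (l : Fin n → Fin r) : Matrix (Fin n ⊕ Fin m) (Fin r) ℝ :=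
  Matrix.of fun p k => Sum.elim (fun i => if l i = k then 1 else 0) (fun _ => 0) p

/-- The true clustering matrix `X⁰ = Z⁰ Z⁰ᵀ`. -/
def trueClustering {n r : ℕ} (m : ℕ) (l : Fin n → Fin r) :
    Matrix (Fin n ⊕ Fin m) (Fin n ⊕ Fin m) ℝ :=
  trueMembership m l * (trueMembership m l).transpose

/-- The Gaussian kernel matrix of a family of points. -/
def gaussianKernel {ι : Type*} {d : ℕ} (θ : ℝ) (y : ι → EuclideanSpace ℝ (Fin d)) :
    Matrix ι ι ℝ :=
  Matrix.of fun i j => Real.exp (-‖y i - y j‖ ^ 2 / (2 * θ ^ 2))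

/-- The entrywise `ℓ₁`-norm of a matrix. -/
def entrywiseL1 {ι : Type*} [Fintype ι] (X : Matrix ι ι ℝ) : ℝ := ∑ i, ∑ j, |X i j|

/-- `X` is an optimal solution of the linear program
`maximize ⟨K - γ E, X⟩ subject to 0 ≤ X i j ≤ 1`. -/
def IsRobustLPSolution {ι : Type*} [Fintype ι] (K : Matrix ι ι ℝ) (γ : ℝ)
    (X : Matrix ι ι ℝ) : Prop :=
  X ∈ {X : Matrix ι ι ℝ | ∀ i j, 0 ≤ X i j ∧ X i j ≤ 1} ∧
    IsMaxOn (fun X : Matrix ι ι ℝ => ∑ i, ∑ j, (K i j - γ) * X i j)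
      {X : Matrix ι ι ℝ | ∀ i j, 0 ≤ X i j ∧ X i j ≤ 1} X

/-- The threshold `τ_in`: the value of the kernel at squared distance `10 Δ² / 64`. -/
def tauIn (Δ θ : ℝ) : ℝ := Real.exp (-(5 * Δ ^ 2) / (64 * θ ^ 2))

/-- The threshold `τ_out`: the value of the kernel at squared distance `Δ² / 2`. -/
def tauOut (Δ θ : ℝ) : ℝ := Real.exp (-Δ ^ 2 / (4 * θ ^ 2))

/-- The outlying point `o i` is good: it is at distance at least `√2 Δ_min` from all centers, and at
most `b` of the outliers (itself included) are within distance `Δ_min / √2` of it. -/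
def IsGoodOutlier {r d m : ℕ} (M : SubGaussianMixture r d) (b : ℝ)
    (o : Fin m → EuclideanSpace ℝ (Fin d)) (i : Fin m) : Prop :=
  (∀ k, √2 * M.deltaMin ≤ ‖o i - M.mean k‖) ∧
    (({j : Fin m | ‖o i - o j‖ ≤ M.deltaMin / √2} : Set (Fin m)).ncard : ℝ) ≤ b

end

end RobustClustering

open RobustClustering

namespace RobustClustering

/-! The program has only box constraints, so it separates over entries: an optimal `X` is 1 where
the kernel exceeds `γ` and 0 where it is below. The window for `γ` means that pairs at squared
distance at most `10Δ²/64` get 1 and pairs at distance above `Δ/√2` get 0. Only three kinds of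
entries can be wrong: inlier pairs on the wrong side of these distances (`badPair`), entries joining
a good outlier to an inlier with large noise (`farNoise`), and entries controlled by counting alone,
namely those of bad outliers and of close pairs of outliers. This bound,
`entrywiseL1_sub_trueClustering_le`, is deterministic, so it holds for all outlier positions, all
solutions and all choices of `Og` at once.

Randomness enters only through the inlier noise, which stays independent and sub-gaussian given the
labels. Each bad event has probability at most `p = exp(-Δ²/(64σ²))`: Gaussian averaging controls
the norm of the noise, and a one-dimensional tail handles different clusters. Hoeffding's
inequality, applied along antidiagonals for pairs, gives at most `2n²(p+t)` bad pairs and fewer than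
`n(p+t)` far points, where `t² = log n_min / n_min` (`one_sub_le_measureReal_few_bad`).

Finally `‖X⁰‖₁ ≥ n²/r` by Cauchy-Schwarz, and since `Δ ≤ Sσ` keeps `p` away from 0, the `o(n²)`
outlier terms are absorbed into `p n²`. -/

/-! ### Gaussian integrals and norm tails of sub-gaussian vectors. -/

lemma lintegral_exp_neg_mul_norm_sq {d : ℕ} {b : ℝ} (hb : 0 < b) :
    ∫⁻ v : EuclideanSpace ℝ (Fin d), ENNReal.ofReal (Real.exp (-b * ‖v‖ ^ 2)) =
      ENNReal.ofReal ((Real.pi / b) ^ ((d : ℝ) / 2)) := by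
  have h := GaussianFourier.integral_rexp_neg_mul_sq_norm
    (V := EuclideanSpace ℝ (Fin d)) hb
  rw [finrank_euclideanSpace_fin] at h
  rw [← h, ofReal_integral_eq_lintegral_ofReal _ (ae_of_all _ fun _ => (Real.exp_pos _).le)]
  refine Integrable.of_integral_ne_zero ?_
  rw [h]
  have := Real.pi_pos
  positivity

/-- Complete the square and translate by `w/(2b)`. Read backwards, this writes `exp(‖w‖²/(4b))` as
an average of exponentials linear in `w`. -/
lemma lintegral_exp_neg_mul_norm_sq_add_inner {d : ℕ} {b : ℝ} (hb : 0 < b)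
    (w : EuclideanSpace ℝ (Fin d)) :
    ∫⁻ v, ENNReal.ofReal (Real.exp (-b * ‖v‖ ^ 2 + inner ℝ v w)) =
      ENNReal.ofReal (Real.exp (‖w‖ ^ 2 / (4 * b))) *
        ENNReal.ofReal ((Real.pi / b) ^ ((d : ℝ) / 2)) := by
  rw [← lintegral_exp_neg_mul_norm_sq hb,
    ← lintegral_sub_right_eq_self (fun v => ENNReal.ofReal (Real.exp (-b * ‖v‖ ^ 2)))
      ((1 / (2 * b)) • w), ← lintegral_const_mul _ (by fun_prop)]
  refine lintegral_congr fun v => ?_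
  rw [← ENNReal.ofReal_mul (Real.exp_pos _).le, ← Real.exp_add, norm_sub_sq_real,
    inner_smul_right, norm_smul, mul_pow, Real.norm_eq_abs, sq_abs]
  congr 2
  field_simp
  ring

/-- All linear marginals of `X` are sub-gaussian, with variance proxy `c` in unit directions. -/
def IsSubgaussianVector {Ω : Type*} [MeasurableSpace Ω] {d : ℕ}
    (X : Ω → EuclideanSpace ℝ (Fin d)) (c : ℝ≥0) (Q : Measure Ω) : Prop :=
  ∀ u : EuclideanSpace ℝ (Fin d),
    HasSubgaussianMGF (fun ω => inner ℝ u (X ω)) (c * ‖u‖₊ ^ 2) Q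

namespace IsSubgaussianVector

variable {Ω : Type*} [MeasurableSpace Ω] {d : ℕ} {X Y : Ω → EuclideanSpace ℝ (Fin d)}
  {c c' : ℝ≥0} {Q : Measure Ω}

lemma mono (h : IsSubgaussianVector X c Q) (hc : c ≤ c') : IsSubgaussianVector X c' Q := by
  refine fun u => ⟨(h u).integrable_exp_mul, fun t => ((h u).mgf_le t).trans ?_⟩
  have : (c : ℝ) ≤ c' := hc
  push_cast
  gcongr

lemma sub_of_indepFun (hX : IsSubgaussianVector X c Q) (hY : IsSubgaussianVector Y c' Q)
    (h : IndepFun X Y Q) : IsSubgaussianVector (fun ω => X ω - Y ω) (c + c') Q := by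
  intro u
  have := (hX u).sub_of_indepFun (hY u) (h.comp (φ := fun x => inner ℝ u x)
    (ψ := fun x => inner ℝ u x) (by fun_prop) (by fun_prop))
  simpa only [inner_sub_right, add_mul] using this

lemma lintegral_exp_inner_le (h : IsSubgaussianVector X c Q) (v : EuclideanSpace ℝ (Fin d)) :
    ∫⁻ ω, ENNReal.ofReal (Real.exp (inner ℝ v (X ω))) ∂Q ≤
      ENNReal.ofReal (Real.exp (c * ‖v‖ ^ 2 / 2)) := by
  have h1 := (h v).integrable_exp_mul 1
  have h2 := (h v).mgf_le 1
  simp only [one_mul, mgf] at h1 h2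
  rw [← ofReal_integral_eq_lintegral_ofReal h1 (ae_of_all _ fun _ => (Real.exp_pos _).le)]
  refine ENNReal.ofReal_le_ofReal (h2.trans_eq ?_)
  push_cast
  congr 1
  ring

/-- Gaussian averaging turns the square into a linear exponent, to which the sub-gaussian bound
applies after Tonelli. With `b = 5c/8` the weight left over is `exp(-c‖v‖²/8)`, as `5/8 - 1/2 =
1/8`. The two normalisations differ by `5^(d/2) ≤ e^d`. -/
lemma lintegral_exp_norm_sq_le [IsProbabilityMeasure Q] (h : IsSubgaussianVector X c Q)
    (hX : Measurable X) (hc : 0 < c) :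
    ∫⁻ ω, ENNReal.ofReal (Real.exp (2 / (5 * c) * ‖X ω‖ ^ 2)) ∂Q ≤
      ENNReal.ofReal (Real.exp d) := by
  have hc' : (0 : ℝ) < c := hc
  have hpi := Real.pi_pos
  have hb : (0 : ℝ) < 5 * c / 8 := by positivity
  have hb' : (0 : ℝ) < c / 8 := by positivity
  set Z : ℝ := (Real.pi / (5 * c / 8)) ^ ((d : ℝ) / 2) with hZ
  set Z' : ℝ := (Real.pi / (c / 8)) ^ ((d : ℝ) / 2) with hZ'
  have hZpos : 0 < Z := by positivity
  have hratio : Z' ≤ Real.exp d * Z := by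
    have h5 : (5 : ℝ) ^ ((d : ℝ) / 2) ≤ Real.exp d := by
      have : (5 : ℝ) ≤ Real.exp 2 := by
        have h1 := Real.exp_one_gt_d9
        have : Real.exp 2 = Real.exp 1 * Real.exp 1 := by rw [← Real.exp_add]; norm_num
        nlinarith
      calc (5 : ℝ) ^ ((d : ℝ) / 2) ≤ (Real.exp 2) ^ ((d : ℝ) / 2) := by gcongr
        _ = Real.exp d := by rw [← Real.exp_mul]; congr 1; ring
    have : Z' = 5 ^ ((d : ℝ) / 2) * Z := by
      rw [hZ, hZ', ← Real.mul_rpow (by norm_num) (by positivity)]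
      congr 1
      field_simp
    rw [this]
    gcongr
  have key : (∫⁻ ω, ENNReal.ofReal (Real.exp (2 / (5 * c) * ‖X ω‖ ^ 2)) ∂Q) * ENNReal.ofReal Z ≤
      ENNReal.ofReal Z' := by
    calc (∫⁻ ω, ENNReal.ofReal (Real.exp (2 / (5 * c) * ‖X ω‖ ^ 2)) ∂Q) * ENNReal.ofReal Z
        = ∫⁻ ω, ∫⁻ v, ENNReal.ofReal
            (Real.exp (-(5 * c / 8) * ‖v‖ ^ 2 + inner ℝ v (X ω))) ∂volume ∂Q := by
          rw [← lintegral_mul_const _ (by fun_prop)]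
          refine lintegral_congr fun ω => ?_
          rw [lintegral_exp_neg_mul_norm_sq_add_inner hb]
          congr 3
          field_simp
          ring
      _ = ∫⁻ v, ∫⁻ ω, ENNReal.ofReal
            (Real.exp (-(5 * c / 8) * ‖v‖ ^ 2 + inner ℝ v (X ω))) ∂Q ∂volume := by
          refine lintegral_lintegral_swap (Measurable.aemeasurable ?_)
          simp only [Function.uncurry_def]
          fun_prop
      _ ≤ ∫⁻ v : EuclideanSpace ℝ (Fin d), ENNReal.ofReal (Real.exp (-(c / 8) * ‖v‖ ^ 2)) := by
          refine lintegral_mono fun v => ?_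
          simp only [Real.exp_add, ENNReal.ofReal_mul (Real.exp_pos _).le]
          rw [lintegral_const_mul _ (by fun_prop)]
          refine (mul_le_mul_right (h.lintegral_exp_inner_le v) _).trans_eq ?_
          rw [← ENNReal.ofReal_mul (Real.exp_pos _).le, ← Real.exp_add]
          congr 2
          ring
      _ = ENNReal.ofReal Z' := lintegral_exp_neg_mul_norm_sq hb'
  have h3 := key.trans (ENNReal.ofReal_le_ofReal hratio)
  rw [ENNReal.ofReal_mul (Real.exp_pos _).le] at h3
  exact (ENNReal.mul_le_mul_iff_left (by simpa using hZpos) ENNReal.ofReal_ne_top).1 h3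

lemma measureReal_le_norm_sq_le [IsProbabilityMeasure Q] (h : IsSubgaussianVector X c Q)
    (hX : Measurable X) (hc : 0 < c) (R : ℝ) :
    Q.real {ω | R ≤ ‖X ω‖ ^ 2} ≤ Real.exp (d - 2 * R / (5 * c)) := by
  have hc' : (0 : ℝ) < c := hc
  have h1 := (mul_meas_ge_le_lintegral (μ := Q)
    (f := fun ω => ENNReal.ofReal (Real.exp (2 / (5 * c) * ‖X ω‖ ^ 2))) (by fun_prop)
    (ENNReal.ofReal (Real.exp (2 / (5 * c) * R)))).trans (h.lintegral_exp_norm_sq_le hX hc)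
  have h2 : {ω | R ≤ ‖X ω‖ ^ 2} ⊆ {ω | ENNReal.ofReal (Real.exp (2 / (5 * c) * R)) ≤
      ENNReal.ofReal (Real.exp (2 / (5 * c) * ‖X ω‖ ^ 2))} := by
    intro ω hω
    have : R ≤ ‖X ω‖ ^ 2 := hω
    exact ENNReal.ofReal_le_ofReal (Real.exp_le_exp.2 (by gcongr))
  have h3 := (mul_le_mul_right (measure_mono (μ := Q) h2) _).trans h1
  have h4 := ENNReal.toReal_mono ENNReal.ofReal_ne_top h3
  rw [ENNReal.toReal_mul, ENNReal.toReal_ofReal (Real.exp_pos _).le,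
    ENNReal.toReal_ofReal (Real.exp_pos _).le, ← le_div_iff₀' (Real.exp_pos _),
    ← Real.exp_sub] at h4
  refine h4.trans_eq ?_
  congr 1
  ring

lemma measureReal_le_inner_le (h : IsSubgaussianVector X c Q) (u : EuclideanSpace ℝ (Fin d))
    {a : ℝ} (ha : 0 ≤ a) :
    Q.real {ω | a ≤ inner ℝ u (X ω)} ≤ Real.exp (-a ^ 2 / (2 * (c * ‖u‖ ^ 2))) := by
  simpa using (h u).measure_ge_le ha

end IsSubgaussianVector

/-! ### Hoeffding bounds for functions of disjoint index pairs. -/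

section BlockSums

variable {Ω ι E : Type*} [MeasurableSpace Ω] [DecidableEq ι] [MeasurableSpace E]
  {Q : Measure Ω} {ξ : ι → Ω → E}

lemma hasSubgaussianMGF_mono {X : Ω → ℝ} {c c' : ℝ≥0} (h : HasSubgaussianMGF X c Q)
    (hc : c ≤ c') : HasSubgaussianMGF X c' Q := by
  refine ⟨h.integrable_exp_mul, fun t => (h.mgf_le t).trans ?_⟩
  have : (c : ℝ) ≤ c' := hc
  gcongr

/-- A sum of sub-gaussian functions of disjoint pairs of independent variables is sub-gaussian. -/
lemma hasSubgaussianMGF_sum_of_pairwiseDisjoint (hξ : iIndepFun ξ Q)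
    (hm : ∀ i, Measurable (ξ i)) (σ : ι → ι) (T : Finset ι)
    (hT : (T : Set ι).PairwiseDisjoint (fun i => ({i, σ i} : Finset ι)))
    (f : ι → E × E → ℝ) (hf : ∀ i, Measurable (f i)) {c : ℝ≥0}
    (hc : ∀ i ∈ T, HasSubgaussianMGF (fun ω => f i (ξ i ω, ξ (σ i) ω)) c Q) :
    HasSubgaussianMGF (fun ω => ∑ i ∈ T, f i (ξ i ω, ξ (σ i) ω)) (T.card * c) Q := by
  have : IsProbabilityMeasure Q := hξ.isProbabilityMeasure
  induction T using Finset.induction_on with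
  | empty => simp
  | insert a T ha ih =>
    have hT' : (T : Set ι).PairwiseDisjoint (fun i => ({i, σ i} : Finset ι)) :=
      hT.subset (by simp)
    -- The new summand and the old sum depend on disjoint blocks of variables, hence are
    -- independent.
    have hdisj : Disjoint ({a, σ a} : Finset ι) (T.biUnion fun i => {i, σ i}) := by
      rw [Finset.disjoint_biUnion_right]
      intro i hi
      exact hT (by simp) (by simp [hi]) (by rintro rfl; exact ha hi)
    set U : Finset ι := T.biUnion fun i => {i, σ i} with hU
    have hmem : ∀ i : T, (i : ι) ∈ U ∧ σ i ∈ U := fun i =>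
      ⟨Finset.mem_biUnion.2 ⟨i, i.2, by simp⟩, Finset.mem_biUnion.2 ⟨i, i.2, by simp⟩⟩
    have hφ : Measurable fun z : ({a, σ a} : Finset ι) → E =>
        f a (z ⟨a, by simp⟩, z ⟨σ a, by simp⟩) :=
      (hf a).comp ((measurable_pi_apply _).prodMk (measurable_pi_apply _))
    have hψ : Measurable fun z : U → E =>
        ∑ i ∈ T.attach, f i (z ⟨i, (hmem i).1⟩, z ⟨σ i, (hmem i).2⟩) :=
      Finset.measurable_sum _ fun i _ =>
        (hf i).comp ((measurable_pi_apply _).prodMk (measurable_pi_apply _))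
    have hind : IndepFun (fun ω => f a (ξ a ω, ξ (σ a) ω))
        (fun ω => ∑ i ∈ T, f i (ξ i ω, ξ (σ i) ω)) Q :=
      ((hξ.indepFun_finset _ _ hdisj hm).comp hφ hψ).congr .rfl
        (ae_of_all _ fun ω => Finset.sum_attach T fun i => f i (ξ i ω, ξ (σ i) ω))
    have h2 := (hc a (by simp)).add_of_indepFun
      (ih hT' fun i hi => hc i (Finset.mem_insert_of_mem hi)) hind
    simp only [Finset.sum_insert ha, Finset.card_insert_of_notMem ha]
    convert h2 using 1
    push_cast
    ring

/-- Hoeffding's inequality for centred indicators, each with variance proxy `1/4`. An upper bound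
`N` replaces `T.card`, so that blocks of different sizes share one threshold; `σ = id` covers single
variables. -/
lemma measureReal_le_sum_indicator_le (hξ : iIndepFun ξ Q)
    (hm : ∀ i, Measurable (ξ i)) (σ : ι → ι) (T : Finset ι)
    (hT : (T : Set ι).PairwiseDisjoint (fun i => ({i, σ i} : Finset ι)))
    (B : ι → Set (E × E)) (hB : ∀ i, MeasurableSet (B i)) {p t : ℝ} (hp0 : 0 ≤ p) (ht : 0 ≤ t)
    (hp : ∀ i ∈ T, Q.real {ω | (ξ i ω, ξ (σ i) ω) ∈ B i} ≤ p) {N : ℕ} (hN : T.card ≤ N) :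
    Q.real {ω | N * (p + t) ≤ ∑ i ∈ T, (B i).indicator (1 : E × E → ℝ) (ξ i ω, ξ (σ i) ω)} ≤
      Real.exp (-2 * t ^ 2 * N) := by
  have : IsProbabilityMeasure Q := hξ.isProbabilityMeasure
  have hpair : ∀ i, Measurable fun ω => (ξ i ω, ξ (σ i) ω) := fun i => (hm i).prodMk (hm _)
  have hind : ∀ i, Measurable ((B i).indicator (1 : E × E → ℝ)) :=
    fun i => measurable_one.indicator (hB i)
  set e : ι → ℝ := fun i => ∫ ω, (B i).indicator (1 : E × E → ℝ) (ξ i ω, ξ (σ i) ω) ∂Q with he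
  have he_eq : ∀ i, e i = Q.real {ω | (ξ i ω, ξ (σ i) ω) ∈ B i} := by
    intro i
    rw [he]
    change ∫ ω, ((fun ω => (ξ i ω, ξ (σ i) ω)) ⁻¹' B i).indicator (1 : Ω → ℝ) ω ∂Q = _
    rw [integral_indicator_one (hpair i (hB i))]
    rfl
  have hsub : ∀ i ∈ T, HasSubgaussianMGF
      (fun ω => (B i).indicator (1 : E × E → ℝ) (ξ i ω, ξ (σ i) ω) - e i) (1 / 4) Q := by
    intro i _
    have h := hasSubgaussianMGF_of_mem_Icc (μ := Q) (a := 0) (b := 1)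
      (X := fun ω => (B i).indicator (1 : E × E → ℝ) (ξ i ω, ξ (σ i) ω))
      ((hind i).comp (hpair i)).aemeasurable (ae_of_all _ fun ω => by
        by_cases h : (ξ i ω, ξ (σ i) ω) ∈ B i <;> simp [h])
    convert h using 1
    ext
    norm_num
  have hsum := hasSubgaussianMGF_mono (hasSubgaussianMGF_sum_of_pairwiseDisjoint hξ hm σ T hT
    (fun i z => (B i).indicator (1 : E × E → ℝ) z - e i) (fun i => (hind i).sub_const _) hsub)
    (c' := N * (1 / 4)) (by gcongr)
  have hle := hsum.measure_ge_le (ε := N * t) (by positivity)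
  refine (measureReal_mono ?_).trans (hle.trans_eq ?_)
  · intro ω hω
    have hω : N * (p + t) ≤ ∑ i ∈ T, (B i).indicator (1 : E × E → ℝ) (ξ i ω, ξ (σ i) ω) := hω
    change N * t ≤ ∑ i ∈ T, ((B i).indicator (1 : E × E → ℝ) (ξ i ω, ξ (σ i) ω) - e i)
    rw [Finset.sum_sub_distrib]
    have h1 : ∑ i ∈ T, e i ≤ T.card * p := by
      rw [← nsmul_eq_mul]
      exact Finset.sum_le_card_nsmul _ _ _ fun i hi => (he_eq i).trans_le (hp i hi)
    have h2 : (T.card : ℝ) * p ≤ N * p := by gcongr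
    linarith
  · congr 1
    push_cast
    rcases Nat.eq_zero_or_pos N with rfl | h
    · simp
    · have : (N : ℝ) ≠ 0 := by positivity
      field_simp
      ring

end BlockSums

/-! ### Counting bad pairs. -/

section PairCounts

variable {Ω E : Type*} [MeasurableSpace Ω] [MeasurableSpace E]
  {Q : Measure Ω} {n : ℕ} {ξ : Fin n → Ω → E}

/-- **Hoeffding's inequality for pair counts**: the antidiagonals `i + j = s` split the pairs into
families of disjoint pairs. -/
lemma measureReal_le_sum_offDiag_indicator_le [NeZero n] (hξ : iIndepFun ξ Q)
    (hm : ∀ i, Measurable (ξ i)) (B : Fin n → Fin n → Set (E × E))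
    (hB : ∀ i j, MeasurableSet (B i j)) (hsymm : ∀ i j a b, (a, b) ∈ B i j ↔ (b, a) ∈ B j i)
    (hdiag : ∀ i, B i i = ∅) {p t : ℝ} (hp0 : 0 ≤ p) (ht : 0 ≤ t)
    (hp : ∀ i j, i ≠ j → Q.real {ω | (ξ i ω, ξ j ω) ∈ B i j} ≤ p) :
    Q.real {ω | 2 * n ^ 2 * (p + t) ≤
      ∑ i, ∑ j, (B i j).indicator (1 : E × E → ℝ) (ξ i ω, ξ j ω)} ≤
      n * Real.exp (-2 * t ^ 2 * n) := by
  have : IsProbabilityMeasure Q := hξ.isProbabilityMeasure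
  set F : Fin n → Fin n → Ω → ℝ :=
    fun i j ω => (B i j).indicator (1 : E × E → ℝ) (ξ i ω, ξ j ω) with hF
  have hFsymm : ∀ i j ω, F i j ω = F j i ω := by
    intro i j ω
    by_cases h : (ξ i ω, ξ j ω) ∈ B i j
    · simp [hF, h, (hsymm _ _ _ _).1 h]
    · simp [hF, h, mt (hsymm _ _ _ _).2 h]
  -- Subtraction is modulo `n`, so `i ↦ s - i` is an involution; `T s` keeps one index of each
  -- two-element orbit. Fixed points contribute nothing by `hdiag`.
  set T : Fin n → Finset (Fin n) := fun s => Finset.univ.filter fun i => i < s - i with hTdef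
  have hsplit : ∀ s ω, ∑ i, F i (s - i) ω = 2 * ∑ i ∈ T s, F i (s - i) ω := by
    intro s ω
    have h1 : ∑ i, F i (s - i) ω = ∑ i, ((if i < s - i then F i (s - i) ω else 0) +
        (if s - i < i then F i (s - i) ω else 0)) := by
      refine Finset.sum_congr rfl fun i _ => ?_
      rcases lt_trichotomy i (s - i) with h | h | h
      · simp [h, h.not_gt]
      · rw [← h]; simp [hF, hdiag]
      · simp [h, h.not_gt]
    rw [h1, Finset.sum_add_distrib, two_mul, hTdef, Finset.sum_filter]
    congr 1
    refine Fintype.sum_equiv (Equiv.subLeft s) _ _ fun i => ?_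
    simp only [Equiv.subLeft_apply, sub_sub_cancel]
    rw [hFsymm]
  have htot : ∀ ω, ∑ i, ∑ j, F i j ω = ∑ s, 2 * ∑ i ∈ T s, F i (s - i) ω := by
    intro ω
    simp only [← hsplit]
    rw [Finset.sum_comm (f := fun s i => F i (s - i) ω)]
    refine Finset.sum_congr rfl fun i _ => ?_
    exact (Fintype.sum_equiv (Equiv.subRight i) _ _ fun s => rfl).symm
  have hone : ∀ s, Q.real {ω | n * (p + t) ≤ ∑ i ∈ T s, F i (s - i) ω} ≤
      Real.exp (-2 * t ^ 2 * n) := by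
    intro s
    refine measureReal_le_sum_indicator_le hξ hm (fun i => s - i) (T s) ?_ (fun i => B i (s - i))
      (fun i => hB _ _) hp0 ht ?_ ?_
    · intro i hi j hj hij
      simp only [hTdef, Finset.coe_filter, Finset.mem_univ, true_and] at hi hj
      have hi : i < s - i := hi
      have hj : j < s - j := hj
      simp only [Function.onFun, Finset.disjoint_insert_left, Finset.disjoint_singleton_left,
        Finset.mem_insert, Finset.mem_singleton, not_or]
      refine ⟨⟨hij, ?_⟩, ?_, ?_⟩
      · rintro h
        have h' : s - i = j := by rw [h, sub_sub_cancel]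
        rw [← h] at hj
        rw [h'] at hi
        exact lt_asymm hi hj
      · rintro h
        have h' : s - j = i := by rw [← h, sub_sub_cancel]
        rw [h] at hi
        rw [h'] at hj
        exact lt_asymm hi hj
      · exact fun h => hij (sub_right_injective h)
    · intro i hi
      exact hp _ _ (Finset.mem_filter.1 hi).2.ne
    · exact (Finset.card_le_univ _).trans_eq (by simp)
  calc Q.real {ω | 2 * n ^ 2 * (p + t) ≤ ∑ i, ∑ j, F i j ω}
      ≤ Q.real (⋃ s, {ω | n * (p + t) ≤ ∑ i ∈ T s, F i (s - i) ω}) := by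
        refine measureReal_mono ?_
        intro ω hω
        have hω : 2 * n ^ 2 * (p + t) ≤ ∑ i, ∑ j, F i j ω := hω
        by_contra hcon
        have hcon : ∀ s, ∑ i ∈ T s, F i (s - i) ω < n * (p + t) := by
          intro s
          by_contra hs
          exact hcon (Set.mem_iUnion.2 ⟨s, not_lt.1 hs⟩)
        rw [htot] at hω
        have : ∑ s, 2 * ∑ i ∈ T s, F i (s - i) ω < ∑ _s : Fin n, 2 * (n * (p + t)) :=
          Finset.sum_lt_sum_of_nonempty Finset.univ_nonempty fun s _ => by linarith [hcon s]
        rw [Finset.sum_const, Finset.card_univ, Fintype.card_fin, nsmul_eq_mul] at this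
        nlinarith
    _ ≤ ∑ s, Q.real {ω | n * (p + t) ≤ ∑ i ∈ T s, F i (s - i) ω} := measureReal_iUnion_fintype_le _
    _ ≤ ∑ _s : Fin n, Real.exp (-2 * t ^ 2 * n) := Finset.sum_le_sum fun s _ => hone s
    _ = n * Real.exp (-2 * t ^ 2 * n) := by simp

end PairCounts

/-! ### Basic facts about the mixture. -/

namespace SubGaussianMixture

variable {r d : ℕ} (M : SubGaussianMixture r d)

lemma scale_le_sigmaMax (k : Fin r) : (M.scale k : ℝ) ≤ M.sigmaMax :=
  le_ciSup (f := fun k : Fin r => (M.scale k : ℝ)) (Set.finite_range _).bddAbove k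

lemma sigmaMax_pos (hr : 0 < r) : 0 < M.sigmaMax :=
  lt_of_lt_of_le (M.scale_pos ⟨0, hr⟩) (M.scale_le_sigmaMax ⟨0, hr⟩)

lemma deltaMin_nonneg : 0 ≤ M.deltaMin := Real.iInf_nonneg fun _ => norm_nonneg _

lemma deltaMin_le {k k' : Fin r} (h : k ≠ k') : M.deltaMin ≤ ‖M.mean k - M.mean k'‖ :=
  ciInf_le (f := fun p : {p : Fin r × Fin r // p.1 ≠ p.2} => ‖M.mean p.1.1 - M.mean p.1.2‖)
    ⟨0, by rintro _ ⟨p, rfl⟩; positivity⟩ ⟨(k, k'), h⟩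

lemma isSubgaussianVector_noise (k : Fin r) :
    IsSubgaussianVector (fun x => x) (M.scale k ^ 2) (M.noise k) := by
  have := M.isProbabilityMeasure_noise k
  intro u
  rcases eq_or_ne u 0 with rfl | hu
  · simp
  · have hu' : ‖u‖ ≠ 0 := norm_ne_zero_iff.2 hu
    have h := (M.subgaussian_noise k ((‖u‖)⁻¹ • u) (by
      rw [norm_smul, norm_inv, norm_norm, inv_mul_cancel₀ hu'])).const_mul ‖u‖
    convert h using 1
    · funext x
      rw [inner_smul_left]
      simp [hu']
    · rw [mul_comm]
      congr 1

end SubGaussianMixture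

/-! ### The noise conditionally on the labels. -/

section Conditioning

lemma setOf_forall_eq_eq_iInter {Ω ι α : Type*} (φ : ι → Ω → α) (l : ι → α) :
    {ω | ∀ i, φ i ω = l i} = ⋂ i, φ i ⁻¹' {l i} := by
  ext ω
  simp

variable {Ω : Type*} [MeasurableSpace Ω] {P : Measure Ω}
  {r d n : ℕ} {M : SubGaussianMixture r d} {φ : Fin n → Ω → Fin r}
  {x : Fin n → Ω → EuclideanSpace ℝ (Fin d)} {l : Fin n → Fin r}

lemma IsMixtureSample.indep_noise_label (h : IsMixtureSample P M φ x) (l : Fin n → Fin r) :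
    iIndepFun (fun i ω => (x i ω - M.mean (l i), φ i ω)) P :=
  h.indep.comp (fun i z => (z.2 - M.mean (l i), z.1)) fun _ =>
    (measurable_snd.sub_const _).prodMk measurable_fst

lemma measure_label_ne_zero (hl : P {ω | ∀ i, φ i ω = l i} ≠ 0) (i : Fin n) :
    P (φ i ⁻¹' {l i}) ≠ 0 :=
  fun h => hl (measure_mono_null (fun _ hω => hω i) h)

/-- The label event is an intersection of events, one for each independent pair (noise, label), so
conditioning preserves the product structure. -/
lemma IsMixtureSample.iIndepFun_noise_cond [IsProbabilityMeasure P]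
    (h : IsMixtureSample P M φ x)
    (hl : P {ω | ∀ i, φ i ω = l i} ≠ 0) :
    iIndepFun (fun i ω => x i ω - M.mean (l i)) (P[|{ω | ∀ i, φ i ω = l i}]) := by
  rw [setOf_forall_eq_eq_iInter]
  exact (h.indep_noise_label l).cond h.measurable_label (measure_label_ne_zero hl)
    fun _ => MeasurableSet.singleton _

lemma IsMixtureSample.map_noise_cond [IsProbabilityMeasure P]
    (h : IsMixtureSample P M φ x)
    (hl : P {ω | ∀ i, φ i ω = l i} ≠ 0) (i : Fin n) :
    (P[|{ω | ∀ i, φ i ω = l i}]).map (fun ω => x i ω - M.mean (l i)) = M.noise (l i) := by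
  have := M.isProbabilityMeasure_noise (l i)
  have hm : Measurable fun ω => x i ω - M.mean (l i) := (h.measurable_point i).sub_const _
  ext B hB
  rw [Measure.map_apply hm hB, setOf_forall_eq_eq_iInter]
  -- For an event about the `i`-th noise, conditioning on all labels reduces to conditioning on the
  -- `i`-th.
  have h1 := cond_iInter (μ := P) (s := {i}) (t := fun i => {l i})
    (f := fun i => (fun ω => x i ω - M.mean (l i)) ⁻¹' B) h.measurable_label
    (h.indep_noise_label l)
    (fun j _ => ⟨B, hB, rfl⟩) (fun i _ => measure_label_ne_zero hl i)
    fun _ => MeasurableSet.singleton _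
  simp only [Finset.mem_singleton, Set.iInter_iInter_eq_left, Finset.prod_singleton] at h1
  rw [h1, cond_apply (h.measurable_label i (MeasurableSet.singleton _))]
  have h2 := h.law i (l i) Set.univ MeasurableSet.univ
  have h3 := h.law i (l i) B hB
  simp only [Set.mem_univ, and_true, measure_univ, mul_one] at h2
  have h0 := measure_label_ne_zero hl i
  change P (φ i ⁻¹' {l i}) = _ at h2
  change P (φ i ⁻¹' {l i} ∩ (fun ω => x i ω - M.mean (l i)) ⁻¹' B) = _ at h3
  rw [h2] at h0 ⊢
  rw [h3, ← mul_assoc, ENNReal.inv_mul_cancel h0 (M.weight.apply_ne_top _), one_mul]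

lemma IsMixtureSample.isSubgaussianVector_noise_cond [IsProbabilityMeasure P]
    (h : IsMixtureSample P M φ x)
    (hl : P {ω | ∀ i, φ i ω = l i} ≠ 0) {σ : ℝ≥0} (hσ : ∀ k, M.scale k ≤ σ) (i : Fin n) :
    IsSubgaussianVector (fun ω => x i ω - M.mean (l i)) (σ ^ 2)
      (P[|{ω | ∀ i, φ i ω = l i}]) := by
  have hm : Measurable fun ω => x i ω - M.mean (l i) := (h.measurable_point i).sub_const _
  intro u
  refine HasSubgaussianMGF.of_map (X := fun x => inner ℝ u x) hm.aemeasurable ?_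
  rw [h.map_noise_cond hl i]
  exact (M.isSubgaussianVector_noise (l i)).mono (pow_le_pow_left' (hσ _) 2) u

end Conditioning

/-! ### Tail bounds at the kernel thresholds. -/

section TailBounds

variable {Ω : Type*} [MeasurableSpace Ω] {Q : Measure Ω} [IsProbabilityMeasure Q] {d : ℕ}
  {X : Ω → EuclideanSpace ℝ (Fin d)} {σ : ℝ≥0} {Δ : ℝ}

lemma dim_le_of_mul_sqrt_le (hσ : 0 < σ) (hd : 8 * σ * √(d : ℝ) ≤ Δ) :
    (d : ℝ) ≤ Δ ^ 2 / (64 * (σ : ℝ) ^ 2) := by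
  have hσ' : (0 : ℝ) < σ := hσ
  rw [le_div_iff₀ (by positivity)]
  calc (d : ℝ) * (64 * (σ : ℝ) ^ 2) = (8 * σ * √(d : ℝ)) ^ 2 := by
        rw [mul_pow, Real.sq_sqrt (by positivity)]; ring
    _ ≤ Δ ^ 2 := by gcongr

/-- The value `10/64` makes the norm tail equal to `exp(d - 2q)` with `q = Δ²/(64σ²)`; the
separation assumption gives `d ≤ q`. -/
lemma IsSubgaussianVector.measureReal_sameCluster_le
    (h : IsSubgaussianVector X (σ ^ 2 + σ ^ 2) Q) (hX : Measurable X) (hσ : 0 < σ)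
    (hd : 8 * σ * √(d : ℝ) ≤ Δ) :
    Q.real {ω | 10 / 64 * Δ ^ 2 ≤ ‖X ω‖ ^ 2} ≤ Real.exp (-Δ ^ 2 / (64 * (σ : ℝ) ^ 2)) := by
  have hσ' : (0 : ℝ) < σ := hσ
  refine (h.measureReal_le_norm_sq_le hX (by positivity) _).trans (Real.exp_le_exp.2 ?_)
  have h1 := dim_le_of_mul_sqrt_le hσ hd
  have h2 : 2 * (10 / 64 * Δ ^ 2) / (5 * ((σ ^ 2 + σ ^ 2 : ℝ≥0) : ℝ)) =
      2 * (Δ ^ 2 / (64 * (σ : ℝ) ^ 2)) := by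
    push_cast
    field_simp
    ring
  rw [h2, neg_div]
  linarith

lemma IsSubgaussianVector.measureReal_outlying_le
    (h : IsSubgaussianVector X (σ ^ 2) Q) (hX : Measurable X) (hσ : 0 < σ)
    (hd : 8 * σ * √(d : ℝ) ≤ Δ) :
    Q.real {ω | Δ ^ 2 / 2 ≤ ‖X ω‖ ^ 2} ≤ Real.exp (-Δ ^ 2 / (64 * (σ : ℝ) ^ 2)) := by
  have hσ' : (0 : ℝ) < σ := hσ
  refine (h.measureReal_le_norm_sq_le hX (by positivity) _).trans (Real.exp_le_exp.2 ?_)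
  have h1 := dim_le_of_mul_sqrt_le hσ hd
  have h0 : 0 ≤ Δ ^ 2 / (64 * (σ : ℝ) ^ 2) := by positivity
  have h2 : 2 * (Δ ^ 2 / 2) / (5 * ((σ ^ 2 : ℝ≥0) : ℝ)) =
      64 / 5 * (Δ ^ 2 / (64 * (σ : ℝ) ^ 2)) := by
    push_cast
    field_simp
  rw [h2, neg_div]
  linarith

lemma inv_sqrt_two_le : (1 : ℝ) / √2 ≤ 3 / 4 := by
  rw [div_le_iff₀ (by positivity)]
  have : (4 / 3 : ℝ) ≤ √2 := Real.le_sqrt_of_sq_le (by norm_num)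
  linarith

/-- Project onto the direction of `w`: since `1 - 1/√2 ≥ 1/4`, the noise must move back by at least
`Δ/4`. The scalar tail with variance proxy `2σ²` gives the constant 64, with no dimension term. -/
lemma IsSubgaussianVector.measureReal_differentClusters_le
    (h : IsSubgaussianVector X (σ ^ 2 + σ ^ 2) Q) (hσ : 0 < σ) (hΔ : 0 < Δ)
    {w : EuclideanSpace ℝ (Fin d)} (hw : Δ ≤ ‖w‖) :
    Q.real {ω | ‖w + X ω‖ ≤ Δ / √2} ≤ Real.exp (-Δ ^ 2 / (64 * (σ : ℝ) ^ 2)) := by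
  have hσ' : (0 : ℝ) < σ := hσ
  have hw0 : ‖w‖ ≠ 0 := (hΔ.trans_le hw).ne'
  set u : EuclideanSpace ℝ (Fin d) := (‖w‖)⁻¹ • w with hu
  have hun : ‖u‖ = 1 := by rw [hu, norm_smul, norm_inv, norm_norm, inv_mul_cancel₀ hw0]
  refine (measureReal_mono ?_).trans
    ((h.measureReal_le_inner_le (-u) (a := Δ / 4) (by positivity)).trans_eq ?_)
  · intro ω hω
    have hω : ‖w + X ω‖ ≤ Δ / √2 := hω
    change Δ / 4 ≤ inner ℝ (-u) (X ω)
    have h1 : inner ℝ u (w + X ω) ≤ ‖w + X ω‖ := by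
      simpa [hun] using real_inner_le_norm u (w + X ω)
    have h2 : inner ℝ u w = ‖w‖ := by
      rw [hu, inner_smul_left, real_inner_self_eq_norm_sq]
      simp only [conj_trivial]
      field_simp
    have h3 : Δ / √2 ≤ 3 / 4 * Δ := by
      have := mul_le_mul_of_nonneg_left inv_sqrt_two_le hΔ.le
      calc Δ / √2 = Δ * (1 / √2) := by ring
        _ ≤ _ := by linarith
    rw [inner_add_right, h2] at h1
    rw [inner_neg_left]
    linarith
  · rw [norm_neg, hun]
    congr 1
    push_cast
    field_simp
    ring

end TailBounds

/-! ### The failure probability. -/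

section Numerics

/-- With `y = n/N ≥ 2` the exponential is `N^(-2y)`, and `y ≤ N^(2y-2)` because `log N ≥ 1`; this is
where `N ≥ 3 > e` is needed. -/
lemma succ_mul_exp_neg_le {N n : ℕ} (hN : 3 ≤ N) (hn : 2 * N ≤ n) :
    (n + 1) * Real.exp (-2 * √(Real.log N / N) ^ 2 * n) ≤ 2 / N := by
  have hN' : (3 : ℝ) ≤ N := by exact_mod_cast hN
  have hn' : 2 * (N : ℝ) ≤ n := by exact_mod_cast hn
  have hNpos : (0 : ℝ) < N := by linarith
  have hL : 1 ≤ Real.log N := by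
    rw [Real.le_log_iff_exp_le hNpos]
    linarith [Real.exp_one_lt_d9]
  set L := Real.log N with hLdef
  set y : ℝ := n / N with hy
  have hy2 : 2 ≤ y := by rw [hy, le_div_iff₀ hNpos]; exact hn'
  have hny : (n : ℝ) = y * N := by rw [hy]; field_simp
  have hNexp : Real.exp L = N := Real.exp_log hNpos
  have h1 : y ≤ Real.exp ((2 * y - 2) * L) := by
    calc y ≤ (2 * y - 2) + 1 := by linarith
      _ ≤ Real.exp (2 * y - 2) := Real.add_one_le_exp _
      _ ≤ Real.exp ((2 * y - 2) * L) := Real.exp_le_exp.2 (by nlinarith)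
  have h2 : Real.exp (2 * y * L) = Real.exp ((2 * y - 2) * L) * N ^ 2 := by
    rw [← hNexp, ← Real.exp_nat_mul, ← Real.exp_add]
    congr 1
    push_cast
    ring
  have h3 : -2 * √(L / N) ^ 2 * n = -(2 * y * L) := by
    rw [Real.sq_sqrt (by positivity), hy]
    field_simp
  rw [h3, Real.exp_neg, ← div_eq_mul_inv, div_le_div_iff₀ (Real.exp_pos _) hNpos, h2, hny]
  have h4 : y * (N : ℝ) ^ 2 ≤ Real.exp ((2 * y - 2) * L) * N ^ 2 := by gcongr
  nlinarith

end Numerics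

/-! ### The event of few bad pairs and few far points. -/

section GoodEvent

variable {r d n : ℕ} (M : SubGaussianMixture r d) (l : Fin n → Fin r)

lemma minClusterSize_le (k : Fin r) :
    minClusterSize l ≤ (Finset.univ.filter fun i => l i = k).card :=
  ciInf_le (OrderBot.bddBelow _) k

lemma mul_minClusterSize_le : r * minClusterSize l ≤ n := by
  calc r * minClusterSize l = ∑ _k : Fin r, minClusterSize l := by simp
    _ ≤ ∑ k, (Finset.univ.filter fun i => l i = k).card :=
        Finset.sum_le_sum fun k _ => minClusterSize_le l k
    _ = n := by
        rw [← Finset.card_eq_sum_card_fiberwise (f := l) (by simp)]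
        simp

/-- The pairs of noise vectors for which the kernel thresholds do not certify whether the `i`-th
and the `j`-th inlier belong to the same cluster. -/
def badPair (i j : Fin n) : Set (EuclideanSpace ℝ (Fin d) × EuclideanSpace ℝ (Fin d)) :=
  {z | i ≠ j ∧ (l i = l j → 10 / 64 * M.deltaMin ^ 2 ≤ ‖z.1 - z.2‖ ^ 2) ∧
    (l i ≠ l j → ‖(M.mean (l i) - M.mean (l j)) + (z.1 - z.2)‖ ≤ M.deltaMin / √2)}

/-- The noise vectors which may bring an inlier close to a good outlier. -/
def farNoise : Set (EuclideanSpace ℝ (Fin d)) := {z | M.deltaMin ^ 2 / 2 ≤ ‖z‖ ^ 2}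

lemma badPair_self (i : Fin n) : badPair M l i i = ∅ := by
  ext z
  simp [badPair]

lemma mem_badPair_comm (i j : Fin n) (a b : EuclideanSpace ℝ (Fin d)) :
    (a, b) ∈ badPair M l i j ↔ (b, a) ∈ badPair M l j i := by
  have h : ‖(M.mean (l j) - M.mean (l i)) + (b - a)‖ =
      ‖(M.mean (l i) - M.mean (l j)) + (a - b)‖ := by
    rw [← norm_neg]
    congr 1
    abel
  simp only [badPair, Set.mem_ofPred_eq, norm_sub_rev b a, h, ne_comm (a := j), eq_comm (a := l j),
    ne_eq]

lemma measurableSet_badPair (i j : Fin n) : MeasurableSet (badPair M l i j) := by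
  unfold badPair
  by_cases h1 : i = j
  · simp [h1]
  · by_cases h2 : l i = l j
    · simp only [h1, h2, ne_eq, not_true_eq_false, not_false_eq_true, true_and, forall_const,
        IsEmpty.forall_iff, and_true]
      exact measurableSet_le (by fun_prop) (by fun_prop)
    · simp only [h1, h2, ne_eq, not_false_eq_true, true_and, forall_const,
        IsEmpty.forall_iff]
      exact measurableSet_le (by fun_prop) (by fun_prop)

lemma measurableSet_farNoise : MeasurableSet (farNoise M) :=
  measurableSet_le (by fun_prop) (by fun_prop)

variable {M l} {Ω : Type*} [MeasurableSpace Ω] {Q : Measure Ω}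
  {ξ : Fin n → Ω → EuclideanSpace ℝ (Fin d)} {σ : ℝ≥0}

lemma measureReal_badPair_le (hξ : iIndepFun ξ Q) (hm : ∀ i, Measurable (ξ i))
    (hsub : ∀ i, IsSubgaussianVector (ξ i) (σ ^ 2) Q) (hσ : 0 < σ) (hΔ : 0 < M.deltaMin)
    (hd : 8 * σ * √(d : ℝ) ≤ M.deltaMin) {i j : Fin n} (hij : i ≠ j) :
    Q.real {ω | (ξ i ω, ξ j ω) ∈ badPair M l i j} ≤
      Real.exp (-M.deltaMin ^ 2 / (64 * (σ : ℝ) ^ 2)) := by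
  have : IsProbabilityMeasure Q := hξ.isProbabilityMeasure
  have h := (hsub i).sub_of_indepFun (hsub j) (hξ.indepFun hij)
  by_cases hl : l i = l j
  · refine (measureReal_mono ?_).trans (h.measureReal_sameCluster_le ((hm i).sub (hm j)) hσ hd)
    exact fun ω hω => hω.2.1 hl
  · refine (measureReal_mono ?_).trans
      (h.measureReal_differentClusters_le hσ hΔ (M.deltaMin_le hl))
    exact fun ω hω => hω.2.2 hl

/-- Union bound: the antidiagonals cost `n` exponentials and the far points one more, which explains
the factor `n + 1` in `succ_mul_exp_neg_le`. -/
lemma one_sub_le_measureReal_few_bad (hr : 2 ≤ r) (hl : r < minClusterSize l)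
    (hξ : iIndepFun ξ Q) (hm : ∀ i, Measurable (ξ i))
    (hsub : ∀ i, IsSubgaussianVector (ξ i) (σ ^ 2) Q) (hσ : 0 < σ) (hΔ : 0 < M.deltaMin)
    (hd : 8 * σ * √(d : ℝ) ≤ M.deltaMin) {p t : ℝ}
    (hp : p = Real.exp (-M.deltaMin ^ 2 / (64 * (σ : ℝ) ^ 2)))
    (ht : t = √(Real.log (minClusterSize l) / minClusterSize l)) :
    1 - 3 * (r : ℝ) / minClusterSize l ≤ Q.real
      {ω | ∑ i, ∑ j, (badPair M l i j).indicator 1 (ξ i ω, ξ j ω) < 2 * n ^ 2 * (p + t) ∧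
        ∑ i, (farNoise M).indicator 1 (ξ i ω) < n * (p + t)} := by
  have : IsProbabilityMeasure Q := hξ.isProbabilityMeasure
  have hN : 3 ≤ minClusterSize l := by omega
  have hn : 2 * minClusterSize l ≤ n :=
    (Nat.mul_le_mul_right _ hr).trans (mul_minClusterSize_le l)
  have : NeZero n := ⟨by omega⟩
  have hp0 : 0 ≤ p := by rw [hp]; positivity
  have ht0 : 0 ≤ t := by rw [ht]; positivity
  set G := {ω | ∑ i, ∑ j, (badPair M l i j).indicator 1 (ξ i ω, ξ j ω) < 2 * n ^ 2 * (p + t) ∧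
    ∑ i, (farNoise M).indicator 1 (ξ i ω) < n * (p + t)} with hG
  have h1 := measureReal_le_sum_offDiag_indicator_le hξ hm (badPair M l)
    (measurableSet_badPair M l) (mem_badPair_comm M l) (badPair_self M l) hp0 ht0
    (fun i j hij => (measureReal_badPair_le hξ hm hsub hσ hΔ hd hij).trans_eq hp.symm)
  have h2 := measureReal_le_sum_indicator_le hξ hm id Finset.univ
    (by simp [Set.PairwiseDisjoint, Set.Pairwise, Function.onFun])
    (fun _ => Prod.fst ⁻¹' farNoise M) (fun _ => measurable_fst (measurableSet_farNoise M)) hp0 ht0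
    (fun i _ => ((hsub i).measureReal_outlying_le (hm i) hσ hd).trans_eq hp.symm)
    (N := n) (by simp)
  have h3 := succ_mul_exp_neg_le hN hn
  rw [← ht] at h3
  set E1 := {ω | 2 * n ^ 2 * (p + t) ≤
    ∑ i, ∑ j, (badPair M l i j).indicator
      (1 : EuclideanSpace ℝ (Fin d) × EuclideanSpace ℝ (Fin d) → ℝ) (ξ i ω, ξ j ω)} with hE1
  set E2 := {ω | n * (p + t) ≤ ∑ i, (Prod.fst ⁻¹' farNoise M).indicator
    (1 : EuclideanSpace ℝ (Fin d) × EuclideanSpace ℝ (Fin d) → ℝ) (ξ i ω, ξ (id i) ω)} with hE2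
  have hcover : Set.univ ⊆ G ∪ (E1 ∪ E2) := by
    intro ω _
    by_cases hω1 : ω ∈ E1
    · exact Or.inr (Or.inl hω1)
    by_cases hω2 : ω ∈ E2
    · exact Or.inr (Or.inr hω2)
    exact Or.inl ⟨not_le.1 hω1, not_le.1 hω2⟩
  have h4 : 1 ≤ Q.real G + (Q.real E1 + Q.real E2) := by
    calc 1 = Q.real Set.univ := by simp
      _ ≤ Q.real (G ∪ (E1 ∪ E2)) := measureReal_mono hcover
      _ ≤ Q.real G + Q.real (E1 ∪ E2) := measureReal_union_le _ _
      _ ≤ _ := by gcongr; exact measureReal_union_le _ _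
  have h5 : 2 / (minClusterSize l : ℝ) ≤ 3 * (r : ℝ) / minClusterSize l := by
    have : (2 : ℝ) ≤ r := by exact_mod_cast hr
    gcongr
    linarith
  linarith

end GoodEvent

/-! ### Optimal solutions are entrywise thresholds. -/

section LinearProgram

variable {ι : Type*} [Fintype ι] {K X : Matrix ι ι ℝ} {γ : ℝ}

/-- Changing a single entry within `[0, 1]` keeps the matrix feasible, so optimality can be tested
entry by entry. -/
lemma IsRobustLPSolution.mul_sub_nonpos (h : IsRobustLPSolution K γ X) (i j : ι) {v : ℝ}
    (hv0 : 0 ≤ v) (hv1 : v ≤ 1) : (K i j - γ) * (v - X i j) ≤ 0 := by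
  classical
  set X' : Matrix ι ι ℝ := fun a b => if a = i ∧ b = j then v else X a b with hX'
  have hmem : X' ∈ {X : Matrix ι ι ℝ | ∀ i j, 0 ≤ X i j ∧ X i j ≤ 1} := by
    intro a b
    by_cases hab : a = i ∧ b = j
    · simp [hX', hab, hv0, hv1]
    · simpa only [hX', hab, if_false] using h.1 a b
  have hle : ∑ a, ∑ b, (K a b - γ) * X' a b ≤ ∑ a, ∑ b, (K a b - γ) * X a b := h.2 hmem
  have hdiff : ∑ a, ∑ b, (K a b - γ) * X' a b - ∑ a, ∑ b, (K a b - γ) * X a b =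
      (K i j - γ) * (v - X i j) := by
    simp only [← Finset.sum_sub_distrib, ← mul_sub]
    rw [Finset.sum_eq_single i, Finset.sum_eq_single j]
    · simp [hX']
    · intro b _ hb
      simp [hX', hb]
    · simp
    · intro a _ ha
      simp [hX', ha]
    · simp
  linarith

lemma IsRobustLPSolution.eq_one (h : IsRobustLPSolution K γ X) {i j : ι} (hK : γ < K i j) :
    X i j = 1 := by
  have h1 := h.mul_sub_nonpos i j zero_le_one le_rfl
  have h2 := (h.1 i j).2
  nlinarith

lemma IsRobustLPSolution.eq_zero (h : IsRobustLPSolution K γ X) {i j : ι} (hK : K i j < γ) :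
    X i j = 0 := by
  have h1 := h.mul_sub_nonpos i j le_rfl zero_le_one
  have h2 := (h.1 i j).1
  nlinarith

variable {d : ℕ} {y : ι → EuclideanSpace ℝ (Fin d)} {θ Δ : ℝ}

lemma IsRobustLPSolution.eq_one_of_norm_le (h : IsRobustLPSolution (gaussianKernel θ y) γ X)
    (hθ : 0 < θ) (hγ : γ < tauIn Δ θ) {i j : ι} (hij : ‖y i - y j‖ ^ 2 ≤ 10 / 64 * Δ ^ 2) :
    X i j = 1 := by
  refine h.eq_one (hγ.trans_le (Real.exp_le_exp.2 ?_))
  rw [div_le_div_iff₀ (by positivity) (by positivity)]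
  have : 0 < θ ^ 2 := by positivity
  nlinarith

lemma IsRobustLPSolution.eq_zero_of_lt_norm (h : IsRobustLPSolution (gaussianKernel θ y) γ X)
    (hΔ : 0 ≤ Δ) (hθ : 0 < θ) (hγ : tauOut Δ θ < γ) {i j : ι} (hij : Δ / √2 < ‖y i - y j‖) :
    X i j = 0 := by
  refine h.eq_zero (lt_of_le_of_lt (Real.exp_le_exp.2 ?_) hγ)
  have h1 : Δ ^ 2 / 2 ≤ ‖y i - y j‖ ^ 2 := by
    calc Δ ^ 2 / 2 = (Δ / √2) ^ 2 := by rw [div_pow, Real.sq_sqrt (by norm_num)]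
      _ ≤ _ := by gcongr
  rw [div_le_div_iff₀ (by positivity) (by positivity)]
  have : 0 < θ ^ 2 := by positivity
  nlinarith

end LinearProgram

/-! ### The size of the true clustering matrix. -/

section TrueClustering

variable {n r m : ℕ} (l : Fin n → Fin r)

lemma trueClustering_inl_inl (i j : Fin n) :
    trueClustering m l (Sum.inl i) (Sum.inl j) = if l i = l j then 1 else 0 := by
  simp [trueClustering, trueMembership, Matrix.mul_apply, eq_comm]

lemma trueClustering_inr_left (a : Fin m) (q : Fin n ⊕ Fin m) :
    trueClustering m l (Sum.inr a) q = 0 := by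
  simp [trueClustering, trueMembership, Matrix.mul_apply]

lemma trueClustering_inr_right (p : Fin n ⊕ Fin m) (b : Fin m) :
    trueClustering m l p (Sum.inr b) = 0 := by
  simp [trueClustering, trueMembership, Matrix.mul_apply]

/-- The norm is the sum of the squared cluster sizes, and the sizes add up to `n`; apply
Cauchy-Schwarz. -/
lemma sq_le_mul_entrywiseL1_trueClustering :
    (n : ℝ) ^ 2 ≤ r * entrywiseL1 (trueClustering m l) := by
  have h1 : entrywiseL1 (trueClustering m l) =
      ∑ k : Fin r, (∑ i, if l i = k then (1 : ℝ) else 0) ^ 2 := by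
    simp only [entrywiseL1, Fintype.sum_sum_type, trueClustering_inl_inl, trueClustering_inr_left,
      trueClustering_inr_right, abs_zero, Finset.sum_const_zero, add_zero]
    simp only [sq, Finset.sum_mul_sum]
    rw [Finset.sum_comm (s := (Finset.univ : Finset (Fin r)))]
    refine Finset.sum_congr rfl fun i _ => ?_
    rw [Finset.sum_comm]
    refine Finset.sum_congr rfl fun j _ => ?_
    by_cases h : l i = l j
    · simp [h]
    · simp [h]
  have h2 : ∑ k : Fin r, ∑ i, (if l i = k then (1 : ℝ) else 0) = n := by
    rw [Finset.sum_comm]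
    simp
  have h3 := sq_sum_le_card_mul_sum_sq (s := (Finset.univ : Finset (Fin r)))
    (f := fun k => ∑ i, if l i = k then (1 : ℝ) else 0)
  rw [h2, ← h1] at h3
  simpa using h3

end TrueClustering

/-! ### The deterministic error bound. -/

section Recovery

variable {r d n m : ℕ} {M : SubGaussianMixture r d} {l : Fin n → Fin r}
  {x : Fin n → EuclideanSpace ℝ (Fin d)} {o : Fin m → EuclideanSpace ℝ (Fin d)} {θ γ b : ℝ}
  {X : Matrix (Fin n ⊕ Fin m) (Fin n ⊕ Fin m) ℝ} {Og : Finset (Fin m)}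

lemma IsRobustLPSolution.abs_le_one {ι : Type*} [Fintype ι] {K X : Matrix ι ι ℝ} {γ : ℝ}
    (h : IsRobustLPSolution K γ X) (i j : ι) : |X i j| ≤ 1 := by
  rw [abs_of_nonneg (h.1 i j).1]
  exact (h.1 i j).2

lemma abs_sub_trueClustering_le_indicator_badPair
    (h : IsRobustLPSolution (gaussianKernel θ (Sum.elim x o)) γ X) (hθ : 0 < θ)
    (hout : tauOut M.deltaMin θ < γ) (hin : γ < tauIn M.deltaMin θ) (i j : Fin n) :
    |(X - trueClustering m l) (Sum.inl i) (Sum.inl j)| ≤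
      (badPair M l i j).indicator 1 (x i - M.mean (l i), x j - M.mean (l j)) := by
  have h01 := h.1 (Sum.inl i) (Sum.inl j)
  rw [Matrix.sub_apply, trueClustering_inl_inl]
  by_cases hbad : (x i - M.mean (l i), x j - M.mean (l j)) ∈ badPair M l i j
  · rw [Set.indicator_of_mem hbad, Pi.one_apply, abs_le]
    split_ifs <;> constructor <;> linarith
  rw [Set.indicator_of_notMem hbad]
  refine (abs_eq_zero.2 (sub_eq_zero.2 ?_)).le
  split_ifs with hl
  · refine h.eq_one_of_norm_le hθ hin ?_
    by_contra hcon
    refine hbad ⟨?_, fun _ => ?_, fun hl' => absurd hl hl'⟩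
    · rintro rfl
      refine hcon ?_
      simp only [sub_self, norm_zero, ne_eq, OfNat.ofNat_ne_zero, not_false_eq_true, zero_pow]
      positivity
    · simp only [Sum.elim_inl, not_le] at hcon
      rw [hl, sub_sub_sub_cancel_right]
      exact hcon.le
  · refine h.eq_zero_of_lt_norm M.deltaMin_nonneg hθ hout ?_
    by_contra hcon
    refine hbad ⟨fun hij => hl (hij ▸ rfl), fun hl' => absurd hl' hl, fun _ => ?_⟩
    simp only [Sum.elim_inl, not_lt] at hcon
    have heq : M.mean (l i) - M.mean (l j) + (x i - M.mean (l i) - (x j - M.mean (l j))) =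
        x i - x j := by abel
    exact (congrArg norm heq).trans_le hcon

/-- Triangle inequality, with `√2 Δ` split into two halves `Δ/√2`: one for the inlier's noise, the
other left as separation. -/
lemma deltaMin_div_sqrt_two_lt_norm_sub {k : Fin r} {z w : EuclideanSpace ℝ (Fin d)}
    (hw : √2 * M.deltaMin ≤ ‖w - M.mean k‖) (hz : z - M.mean k ∉ farNoise M) :
    M.deltaMin / √2 < ‖z - w‖ := by
  have hz : ‖z - M.mean k‖ ^ 2 < M.deltaMin ^ 2 / 2 := not_le.1 hz
  have h0 := M.deltaMin_nonneg
  have h1 : ‖z - M.mean k‖ < M.deltaMin / √2 := by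
    refine lt_of_pow_lt_pow_left₀ 2 (by positivity) ?_
    rwa [div_pow, Real.sq_sqrt (by norm_num)]
  have h2 : √2 * M.deltaMin = M.deltaMin / √2 + M.deltaMin / √2 := by
    have : √2 * √2 = 2 := Real.mul_self_sqrt (by norm_num)
    field_simp
    nlinarith
  have h3 : ‖w - M.mean k‖ ≤ ‖z - w‖ + ‖z - M.mean k‖ := by
    rw [norm_sub_rev z w]
    exact norm_sub_le_norm_sub_add_norm_sub _ _ _
  linarith

lemma sum_inlier_outlier_le (Y : Fin n → Fin m → ℝ) (F : Fin n → ℝ) (hY1 : ∀ i a, Y i a ≤ 1)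
    (hY : ∀ i, ∀ a ∈ Og, Y i a ≤ F i) :
    ∑ i, ∑ a, Y i a ≤ Og.card * ∑ i, F i + n * (Ogᶜ.card : ℝ) := by
  have : ∀ i, ∑ a, Y i a ≤ Og.card * F i + (Ogᶜ.card : ℝ) := by
    intro i
    rw [← Finset.sum_add_sum_compl Og]
    refine add_le_add ?_ ?_
    · rw [← nsmul_eq_mul]
      exact Finset.sum_le_card_nsmul _ _ _ fun a ha => hY i a ha
    · simpa using Finset.sum_le_card_nsmul Ogᶜ (fun a => Y i a) 1 fun a _ => hY1 i a
  refine (Finset.sum_le_sum fun i _ => this i).trans_eq ?_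
  rw [Finset.sum_add_distrib, ← Finset.mul_sum]
  simp

/-- A row of a good outlier is supported on its at most `b` close outliers; a row of a bad one is
bounded by its full length `m`. -/
lemma sum_outlier_outlier_le
    (h : IsRobustLPSolution (gaussianKernel θ (Sum.elim x o)) γ X) (hθ : 0 < θ)
    (hout : tauOut M.deltaMin θ < γ) (hg : ∀ a ∈ Og, IsGoodOutlier M b o a) :
    ∑ a, ∑ a', |X (Sum.inr a) (Sum.inr a')| ≤
      Og.card * b + Ogᶜ.card * ((Og.card : ℝ) + Ogᶜ.card) := by
  classical
  rw [← Finset.sum_add_sum_compl Og]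
  refine add_le_add ?_ ?_
  · rw [← nsmul_eq_mul]
    refine Finset.sum_le_card_nsmul _ _ _ fun a ha => ?_
    refine le_trans ?_ (hg a ha).2
    calc ∑ a', |X (Sum.inr a) (Sum.inr a')|
        ≤ ∑ a', if ‖o a - o a'‖ ≤ M.deltaMin / √2 then (1 : ℝ) else 0 := by
          refine Finset.sum_le_sum fun a' _ => ?_
          split_ifs with hle
          · exact h.abs_le_one (Sum.inr a) (Sum.inr a')
          · rw [h.eq_zero_of_lt_norm (i := Sum.inr a) (j := Sum.inr a') M.deltaMin_nonneg hθ hout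
              (not_le.1 hle), abs_zero]
      _ = _ := by
          rw [Set.ncard_eq_toFinset_card', Set.toFinset_ofPred, Finset.sum_boole]
  · rw [← nsmul_eq_mul]
    refine Finset.sum_le_card_nsmul _ _ _ fun a _ => ?_
    rw [← Nat.cast_add, Finset.card_add_card_compl, Fintype.card_fin]
    calc ∑ a', |X (Sum.inr a) (Sum.inr a')| ≤ ∑ _a' : Fin m, (1 : ℝ) :=
          Finset.sum_le_sum fun a' _ => h.abs_le_one (Sum.inr a) (Sum.inr a')
      _ = m := by simp

lemma entrywiseL1_sub_trueClustering_le
    (h : IsRobustLPSolution (gaussianKernel θ (Sum.elim x o)) γ X) (hθ : 0 < θ)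
    (hout : tauOut M.deltaMin θ < γ) (hin : γ < tauIn M.deltaMin θ)
    (hg : ∀ a ∈ Og, IsGoodOutlier M b o a) :
    entrywiseL1 (X - trueClustering m l) ≤
      ∑ i, ∑ j, (badPair M l i j).indicator 1 (x i - M.mean (l i), x j - M.mean (l j)) +
      2 * (Og.card * ∑ i, (farNoise M).indicator 1 (x i - M.mean (l i)) + n * (Ogᶜ.card : ℝ)) +
      (Og.card * b + Ogᶜ.card * ((Og.card : ℝ) + Ogᶜ.card)) := by
  have hcross : ∀ i, ∀ a ∈ Og, x i - M.mean (l i) ∉ farNoise M →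
      M.deltaMin / √2 < ‖x i - o a‖ := fun i a ha hi =>
    deltaMin_div_sqrt_two_lt_norm_sub ((hg a ha).1 (l i)) hi
  have h1 : ∑ i, ∑ a, |X (Sum.inl i) (Sum.inr a)| ≤
      Og.card * ∑ i, (farNoise M).indicator 1 (x i - M.mean (l i)) + n * (Ogᶜ.card : ℝ) := by
    refine sum_inlier_outlier_le _ _
      (fun i a => h.abs_le_one (Sum.inl i) (Sum.inr a)) fun i a ha => ?_
    by_cases hi : x i - M.mean (l i) ∈ farNoise M
    · rw [Set.indicator_of_mem hi]
      exact h.abs_le_one (Sum.inl i) (Sum.inr a)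
    · rw [h.eq_zero_of_lt_norm (i := Sum.inl i) (j := Sum.inr a) M.deltaMin_nonneg hθ hout (hcross i a ha hi)]
      simp [hi]
  have h2 : ∑ a, ∑ i, |X (Sum.inr a) (Sum.inl i)| ≤
      Og.card * ∑ i, (farNoise M).indicator 1 (x i - M.mean (l i)) + n * (Ogᶜ.card : ℝ) := by
    rw [Finset.sum_comm]
    refine sum_inlier_outlier_le _ _
      (fun i a => h.abs_le_one (Sum.inr a) (Sum.inl i)) fun i a ha => ?_
    by_cases hi : x i - M.mean (l i) ∈ farNoise M
    · rw [Set.indicator_of_mem hi]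
      exact h.abs_le_one (Sum.inr a) (Sum.inl i)
    · rw [h.eq_zero_of_lt_norm (i := Sum.inr a) (j := Sum.inl i) M.deltaMin_nonneg hθ hout
        ((hcross i a ha hi).trans_eq (norm_sub_rev _ _))]
      simp [hi]
  have h3 := sum_outlier_outlier_le h hθ hout hg
  have h4 : ∑ i, ∑ j, |(X - trueClustering m l) (Sum.inl i) (Sum.inl j)| ≤
      ∑ i, ∑ j, (badPair M l i j).indicator 1 (x i - M.mean (l i), x j - M.mean (l j)) :=
    Finset.sum_le_sum fun i _ => Finset.sum_le_sum fun j _ =>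
      abs_sub_trueClustering_le_indicator_badPair h hθ hout hin i j
  simp only [entrywiseL1, Fintype.sum_sum_type, Finset.sum_add_distrib]
  have h5 : ∀ p a, (X - trueClustering m l) p (Sum.inr a) = X p (Sum.inr a) := by
    simp [Matrix.sub_apply, trueClustering_inr_right]
  have h6 : ∀ q a, (X - trueClustering m l) (Sum.inr a) q = X (Sum.inr a) q := by
    simp [Matrix.sub_apply, trueClustering_inr_left]
  simp only [h5, h6]
  linarith

end Recovery

/-! ### Assembling the constants. -/

/-- In units of `n²μ`, bad pairs cost 4, the two inlier–good outlier blocks `4A`, and the absorbed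
outlier terms 1, giving `5 + 4A`. The two inlier–bad outlier blocks give `2rb/n`. -/
lemma relative_error_le {n r W err bad far a b g p t A μ : ℝ} (hn : 0 < n) (hr : 0 < r)
    (hW : n ^ 2 ≤ r * W) (hA : 0 ≤ A) (hb0 : 0 ≤ b) (ha0 : 0 ≤ a) (hp0 : 0 ≤ p) (ht0 : 0 ≤ t)
    (herr : err ≤ bad + 2 * (a * far + n * b) + (a * g + b * (a + b)))
    (hbad : bad ≤ 2 * n ^ 2 * (p + t)) (hfar : far ≤ n * (p + t)) (ha : a ≤ A * n) (hb : b ≤ g)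
    (hg : 2 * A * n * g + g ^ 2 ≤ p * n ^ 2) (hp : p ≤ μ) (ht : t ≤ μ) :
    err / W ≤ (5 + 4 * A) * r * μ + 2 * r * b / n := by
  have hWpos : 0 < W := by
    by_contra hcon
    have := sq_pos_of_pos hn
    nlinarith
  have hg0 : 0 ≤ g := hb0.trans hb
  have h1 : a * far ≤ A * n * (n * (p + t)) := by
    calc a * far ≤ a * (n * (p + t)) := by gcongr
      _ ≤ _ := by gcongr
  have h2 : a * g ≤ A * n * g := by gcongr
  have h3 : b * (a + b) ≤ g * (A * n + g) := by gcongr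
  have h4 : n ^ 2 * (p + t) ≤ n ^ 2 * (2 * μ) := by gcongr; linarith
  have h5 : A * (n ^ 2 * (p + t)) ≤ A * (n ^ 2 * (2 * μ)) := by gcongr
  have h6 : p * n ^ 2 ≤ μ * n ^ 2 := by gcongr
  have h7 : err ≤ n ^ 2 * ((5 + 4 * A) * μ + 2 * b / n) := by
    have : n ^ 2 * (2 * b / n) = 2 * (n * b) := by field_simp
    rw [mul_add, this]
    nlinarith
  have h8 : 0 ≤ (5 + 4 * A) * μ + 2 * b / n := by
    have : 0 ≤ μ := hp0.trans hp
    positivity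
  rw [div_le_iff₀ hWpos]
  calc err ≤ n ^ 2 * ((5 + 4 * A) * μ + 2 * b / n) := h7
    _ ≤ r * W * ((5 + 4 * A) * μ + 2 * b / n) := by gcongr
    _ = _ := by ring

lemma deltaMin_pos_of_thresholds {r d : ℕ} {M : SubGaussianMixture r d} {θ γ : ℝ}
    (hout : tauOut M.deltaMin θ < γ) (hin : γ < tauIn M.deltaMin θ) : 0 < M.deltaMin := by
  refine M.deltaMin_nonneg.lt_of_ne fun h0 => ?_
  rw [← h0] at hout hin
  simp only [tauOut, tauIn, ne_eq, OfNat.ofNat_ne_zero, not_false_eq_true, zero_pow, neg_zero,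
    zero_div, mul_zero, Real.exp_zero] at hout hin
  exact lt_asymm hout hin

/-- A lower bound on `p` depending on `S` alone, which lets `n₀` be chosen before the mixture. -/
lemma exp_neg_sq_le_of_le_mul {S σ Δ : ℝ} (hσ : 0 < σ) (hΔ : 0 ≤ Δ) (h : Δ ≤ S * σ) :
    Real.exp (-S ^ 2 / 64) ≤ Real.exp (-Δ ^ 2 / (64 * σ ^ 2)) := by
  refine Real.exp_le_exp.2 ?_
  rw [div_le_div_iff₀ (by norm_num) (by positivity)]
  have : Δ ^ 2 ≤ (S * σ) ^ 2 := by gcongr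
  nlinarith

lemma eventually_quadratic_le {g : ℕ → ℝ} (hg : g =o[atTop] (fun n : ℕ => (n : ℝ))) {A ε : ℝ}
    (hA : 0 ≤ A) (hε : 0 < ε) :
    ∀ᶠ n : ℕ in atTop, 0 ≤ g n → 2 * A * n * g n + g n ^ 2 ≤ ε * (n : ℝ) ^ 2 := by
  -- The entry 1 gives `g² ≤ n g`; the other makes `(2A + 1) n g ≤ ε n²`.
  have hδ : 0 < min 1 (ε / (2 * A + 1)) := by positivity
  filter_upwards [hg.bound hδ] with n hn h0
  rw [Real.norm_of_nonneg h0, Real.norm_natCast] at hn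
  have h1 : g n ≤ n := hn.trans (mul_le_of_le_one_left (by positivity) (min_le_left _ _))
  have h2 : g n ≤ ε / (2 * A + 1) * n :=
    hn.trans (mul_le_mul_of_nonneg_right (min_le_right _ _) (by positivity))
  calc 2 * A * n * g n + g n ^ 2 ≤ 2 * A * n * g n + n * g n := by nlinarith
    _ = (2 * A + 1) * n * g n := by ring
    _ ≤ (2 * A + 1) * n * (ε / (2 * A + 1) * n) := by gcongr
    _ = ε * (n : ℝ) ^ 2 := by field_simp

end RobustClustering

theorem mainTheorem3 (A : ℝ) (hA : 0 < A) :
    ∃ C : ℝ, 0 < C ∧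
      ∀ g : ℕ → ℝ, g =o[atTop] (fun n : ℕ => (n : ℝ)) → ∀ S : ℝ, ∃ n₀ : ℕ,
      ∀ (Ω : Type*) [MeasurableSpace Ω] (P : Measure Ω) [IsProbabilityMeasure P]
        (r d n m : ℕ) (M : SubGaussianMixture r d)
        (φ : Fin n → Ω → Fin r) (x : Fin n → Ω → EuclideanSpace ℝ (Fin d))
        (o : Fin m → Ω → EuclideanSpace ℝ (Fin d)) (θ γ : ℝ),
        2 ≤ r → n₀ ≤ n → IsMixtureSample P M φ x → (∀ i, Measurable (o i)) →
        M.deltaMin ≤ S * M.sigmaMax →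
        8 * M.sigmaMax * √(d : ℝ) ≤ M.deltaMin →
        0 < θ → tauOut M.deltaMin θ < γ → γ < tauIn M.deltaMin θ →
        ∀ l : Fin n → Fin r, P {ω | ∀ i, φ i ω = l i} ≠ 0 → r < minClusterSize l →
          1 - 3 * (r : ℝ) / (minClusterSize l : ℝ) ≤
            (P[|{ω | ∀ i, φ i ω = l i}]).real
              {ω | ∀ (X : Matrix (Fin n ⊕ Fin m) (Fin n ⊕ Fin m) ℝ) (Og : Finset (Fin m)),
                IsRobustLPSolution
                  (gaussianKernel θ (Sum.elim (fun i => x i ω) (fun i => o i ω))) γ X →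
                (∀ i ∈ Og, IsGoodOutlier M (g n) (fun j => o j ω) i) →
                (Og.card : ℝ) ≤ A * n → (Ogᶜ.card : ℝ) ≤ g n →
                entrywiseL1 (X - trueClustering m l) / entrywiseL1 (trueClustering m l) ≤
                  C * r * max (Real.exp (-M.deltaMin ^ 2 / (64 * M.sigmaMax ^ 2)))
                      (√(Real.log (minClusterSize l) / (minClusterSize l)))
                    + 2 * r * (Ogᶜ.card : ℝ) / n} := by
  refine ⟨5 + 4 * A, by positivity, fun g hg S => ?_⟩
  obtain ⟨n₀, hn₀⟩ := eventually_atTop.1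
    (eventually_quadratic_le hg hA.le (Real.exp_pos (-S ^ 2 / 64)))
  refine ⟨n₀, ?_⟩
  intro Ω _ P _ r d n m M φ x o θ γ hr hn hsample _ hS hd hθ hout hin l hl hmin
  have hσ : 0 < M.sigmaMax := M.sigmaMax_pos (by omega)
  have hΔ : 0 < M.deltaMin := deltaMin_pos_of_thresholds hout hin
  have hnpos : 0 < n := by
    have := mul_minClusterSize_le l
    have : 0 < r * minClusterSize l := Nat.mul_pos (by omega) (by omega)
    omega
  have hprob := cond_isProbabilityMeasure hl
  set σ : ℝ≥0 := ⟨M.sigmaMax, hσ.le⟩ with hσdef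
  have hσcoe : (σ : ℝ) = M.sigmaMax := rfl
  have hgood := one_sub_le_measureReal_few_bad (M := M) hr hmin
    (hsample.iIndepFun_noise_cond hl) (fun i => (hsample.measurable_point i).sub_const _)
    (hsample.isSubgaussianVector_noise_cond hl (σ := σ) M.scale_le_sigmaMax)
    hσ hΔ hd rfl rfl
  refine hgood.trans (measureReal_mono ?_)
  rintro ω ⟨hbad, hfar⟩ X Og hX hOg hcard hcardc
  rw [hσcoe] at hbad hfar
  refine relative_error_le (by exact_mod_cast hnpos) (by exact_mod_cast (by omega : 0 < r))
    (sq_le_mul_entrywiseL1_trueClustering l) hA.le (by positivity) (by positivity)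
    (Real.exp_pos _).le (Real.sqrt_nonneg _)
    (entrywiseL1_sub_trueClustering_le hX hθ hout hin hOg) hbad.le hfar.le hcard hcardc ?_
    (le_max_left _ _) (le_max_right _ _)
  -- `g n ≥ 0` because it bounds a cardinality.
  refine (hn₀ n hn (le_trans (by positivity) hcardc)).trans ?_
  exact mul_le_mul_of_nonneg_right (exp_neg_sq_le_of_le_mul hσ hΔ.le hS) (by positivity)
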